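/- Let $G$ be a directed graph, not necessarily finite or acyclic (loops and parallel edges are allowed), with edge weights $\mathrm{wt}(e)$ in a commutative Hausdorff topological ring $R$ (for example an arbitrary commutative ring with the discrete topology, $\mathbb{R}$, or a ring of formal power series), and let $B$ be a set of vertices with a total order. The weight of a walk is the product of the weights of its edges, and the weight of a family of walks is the product of the weights of its members. The loop-erasure $\mathrm{LE}(w)$ of a walk $w$ is the path obtained by following $w$ and erasing each loop as it forms. For $k$-tuples $\mathbf a=(a_1,\dots,a_k)$ and $\mathbf b=(b_1,\dots,b_k)$ of vertices let $\mathrm{Walk}_k(\mathbf a,\mathbf b)$ be the set of families $(w_1,\dots,w_k)$ of walks $w_i\colon a_i\to b_i$ such that $w_j$ is vertex-disjoint from $\mathrm{LE}(w_i)$ whenever $i<j$, and put \[\tilde W_k(\mathbf a,\mathbf b)=\sum_{\sigma\in S_k}\mathrm{sgn}(\sigma)\sum_{\mathbf w\in \mathrm{Walk}_k(\mathbf a,\mathbf b_\sigma)}\mathrm{wt}(\mathbf w),\qquad \mathbf b_\sigma=(b_{\sigma(1)},\dots,b_{\sigma(k)}),\] \[\tilde Q_k(\mathbf a)=\sum_{\substack{\mathbf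 b\in B^k\\ b_1<\dots<b_k}}\tilde W_k(\mathbf a,\mathbf b).\] Let $k$ be even and let $\mathbf a=(a_1,\dots,a_k)$ be a tuple of vertices of $G$. Assume that the sums involved converge unconditionally: the sums in the definitions of $\tilde Q_k(\mathbf a)$ and of $\tilde Q_2(a_i,a_j)$ for all $i,j$ (where the inner sums over $\mathrm{Walk}_k(\mathbf a,\mathbf b)$, $\mathrm{Walk}_2((a_i,a_j),\mathbf b)$ are taken for all tuples $\mathbf b$ in $B$), and, for all distinct indices $i_1,\dots,i_m$ and all $b_1,\dots,b_m\in B$, the sum of the weights of all families of walks $w_r\colon a_{i_r}\to b_r$, $1\le r\le m$. Then the matrix $\bigl(\tilde Q_2(a_i,a_j)\bigr)_{i,j=1}^k$ is skew-symmetric with zero diagonal, and \[\tilde Q_k(\mathbf a)=\mathrm{Pf}\bigl(\tilde Q_2(a_i,a_j)\bigr)_{i,j=1}^k .\] Here $\mathrm{Pf}(M)$ is the sum, over the perfect matchings of $\{1,\dots,k\}$, of the product of the entries $M_{ij}$ with $i<j$ matched, with sign $(-1)^c$, where $c$ is the number of crossings of the matching. If moreover $G$ is acyclic, then the same identity holds,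 without any compatibility assumption on $\mathbf a$ and $B$, when $\mathrm{Walk}_k(\mathbf a,\mathbf b)$ is replaced by the set of families of pairwise vertex-disjoint paths $p_i\colon a_i\to b_i$ in the definitions of $\tilde W_k$ and $\tilde Q_k$ (and likewise for $k=2$). -/

import Mathlib

/-!
A directed graph is a `Quiver` (loops and parallel edges are allowed), a walk from `a` to `b` is a
`Quiver.Path a b`, `Quiver.Path.vertices` is the list of all vertices a walk visits (both ends
included), and `Quiver.Path.weight wt` is the product of the weights of its edges.
-/

namespace LoopErasedWalks

open Quiver

section Walks

variable {V : Type*} [Quiver V]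

open scoped Classical in
/-- The initial segment of a walk `p`, up to the first visit to the vertex `c`. -/
noncomputable def initialSegment {a : V} :
    ∀ {b : V} (p : Path a b) (c : V), c ∈ p.vertices → Path a c
  | _, Path.nil, _, h => (List.mem_singleton.mp h) ▸ Path.nil
  | _, Path.cons p e, c, h =>
      if h' : c ∈ p.vertices then initialSegment p c h'
      else (((Path.mem_vertices_cons p e).mp h).resolve_left h') ▸ p.cons e

open scoped Classical in
/-- The loop-erasure of a walk: follow the walk and, whenever a step leads back to a vertex `c` of
the path kept so far, delete the loop at `c` that this step closes. -/
noncomputable def loopErasure {a : V} : ∀ {b : V}, Path a b → Path a b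
  | _, Path.nil => Path.nil
  | c, Path.cons p e =>
      if h : c ∈ (loopErasure p).vertices then initialSegment (loopErasure p) c h
      else (loopErasure p).cons e

/-- Two walks are vertex-disjoint. -/
def VertexDisjoint {a b c d : V} (p : Path a b) (q : Path c d) : Prop :=
  ∀ v, v ∈ p.vertices → v ∉ q.vertices

/-- All families `(w₁, …, w_k)` of walks `w_i : a_i → b_i`, without any disjointness condition. -/
abbrev AllFamilies {k : ℕ} (a b : Fin k → V) : Type _ :=
  ∀ i, Path (a i) (b i)

/-- `Walk_k(a, b)`: the families of walks `w_i : a_i → b_i` such that `w_j` is vertex-disjoint from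
the loop-erasure of `w_i` whenever `i < j`. -/
abbrev WalkFamilies {k : ℕ} (a b : Fin k → V) : Type _ :=
  {w : AllFamilies a b // ∀ i j, i < j → VertexDisjoint (w j) (loopErasure (w i))}

/-- `Path_k(a, b)`: the families of pairwise vertex-disjoint paths `p_i : a_i → b_i`, where a path
is a walk without repeated vertices. -/
abbrev PathFamilies {k : ℕ} (a b : Fin k → V) : Type _ :=
  {p : AllFamilies a b // (∀ i, (p i).vertices.Nodup) ∧ ∀ i j, i ≠ j → VertexDisjoint (p i) (p j)}

variable (V) in
/-- The graph has no directed cycle: the only closed walks are the trivial ones. -/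
def IsAcyclic : Prop :=
  ∀ (v : V) (p : Path v v), p = Path.nil

end Walks

section Sums

variable {V : Type*} [Quiver V] {R : Type*} [CommRing R]

/-- The weight of a family of walks is the product of the weights of its members. -/
def familyWeight (wt : ∀ {u v : V}, (u ⟶ v) → R) {k : ℕ} {a b : Fin k → V}
    (w : AllFamilies a b) : R :=
  ∏ i, (w i).weight wt

variable [TopologicalSpace R]

/-- The signed sum `W̃_k(a, b)` of the weights of the families in `Walk_k(a, b_σ)`. -/
noncomputable def signedWalkSum (wt : ∀ {u v : V}, (u ⟶ v) → R) {k : ℕ} (a b : Fin k → V) : R :=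
  ∑ σ : Equiv.Perm (Fin k),
    ((Equiv.Perm.sign σ : ℤ) : R) * ∑' w : WalkFamilies a (b ∘ σ), familyWeight wt w.1

/-- The signed sum `P̃_k(a, b)` of the weights of the families in `Path_k(a, b_σ)`. -/
noncomputable def signedPathSum (wt : ∀ {u v : V}, (u ⟶ v) → R) {k : ℕ} (a b : Fin k → V) : R :=
  ∑ σ : Equiv.Perm (Fin k),
    ((Equiv.Perm.sign σ : ℤ) : R) * ∑' p : PathFamilies a (b ∘ σ), familyWeight wt p.1

/-- The tuples `b₁ < ⋯ < b_k` in an ordered vertex subset `B`. -/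
abbrev IncreasingTuples (B : Set V) [LinearOrder B] (k : ℕ) : Type _ :=
  {b : Fin k → B // StrictMono b}

/-- `Q̃_k(a)`: the sum of `W̃_k(a, b)` over the increasing tuples `b` in `B`. -/
noncomputable def walkQ (wt : ∀ {u v : V}, (u ⟶ v) → R) (B : Set V) [LinearOrder B]
    {k : ℕ} (a : Fin k → V) : R :=
  ∑' b : IncreasingTuples B k, signedWalkSum wt a (fun i => (b.1 i : V))

/-- The analogue of `walkQ` for families of disjoint paths: the sum of `P̃_k(a, b)` over the
increasing tuples `b` in `B`. -/
noncomputable def pathQ (wt : ∀ {u v : V}, (u ⟶ v) → R) (B : Set V) [LinearOrder B]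
    {k : ℕ} (a : Fin k → V) : R :=
  ∑' b : IncreasingTuples B k, signedPathSum wt a (fun i => (b.1 i : V))

/-- The sums over families of walks that the determinants `det W(a_i, b_j)` expand into converge:
for every choice of distinct entries of `a` and every choice of targets in `B`, the weights of all
families of walks from those entries to those targets are summable. For a single entry this is the
convergence of `W(a_i, b)`. -/
def WalkSumsConverge (wt : ∀ {u v : V}, (u ⟶ v) → R) (B : Set V) {k : ℕ} (a : Fin k → V) : Prop :=
  ∀ (m : ℕ) (ι : Fin m ↪ Fin k) (b : Fin m → B),
    Summable fun w : AllFamilies (a ∘ ι) (fun i => (b i : V)) => familyWeight wt w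

/-- The sums in the definition of `Q̃_k(a)` converge: the sums over `Walk_k(a, b)` for `b ∈ B^k`, and
the sum over increasing tuples `b`. The latter is a finite sum if `B` is finite. -/
structure QSumsConverge (wt : ∀ {u v : V}, (u ⟶ v) → R) (B : Set V) [LinearOrder B]
    {k : ℕ} (a : Fin k → V) : Prop where
  families : ∀ b : Fin k → B,
    Summable fun w : WalkFamilies a (fun i => (b i : V)) => familyWeight wt w.1
  tuples :
    Summable fun b : IncreasingTuples B k => signedWalkSum wt a (fun i => (b.1 i : V))

end Sums

section Pfaffian

/-- A perfect matching of `{1, …, n}`, as the involution without fixed points that sends each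
element to its partner. -/
abbrev PerfectMatching (n : ℕ) : Type :=
  {f : Equiv.Perm (Fin n) // ∀ i, f (f i) = i ∧ f i ≠ i}

/-- The number of crossings of a perfect matching: pairs of arcs `i — f i`, `j — f j` with
`i < j < f i < f j`. -/
def crossings {n : ℕ} (f : PerfectMatching n) : ℕ :=
  (Finset.univ.filter fun p : Fin n × Fin n =>
    p.1 < p.2 ∧ p.2 < f.1 p.1 ∧ f.1 p.1 < f.1 p.2).card

/-- The Pfaffian of a skew-symmetric matrix, as a polynomial in its above-diagonal entries: the sum
over the perfect matchings of the rows of the products of the entries `M i j` with `i < j` matched,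
with a sign given by the parity of the number of crossings. -/
def pfaffian {n : ℕ} {R : Type*} [CommRing R] (M : Matrix (Fin n) (Fin n) R) : R :=
  ∑ f : PerfectMatching n,
    (-1) ^ crossings f * ∏ i with i < f.1 i, M i (f.1 i)

end Pfaffian

end LoopErasedWalks

/-! Write `W(u, v)` for the sum of the weights of all walks from `u` to `v`. Two identities combine.

Fomin's identity (`signedWalkSum_eq_det`) says that `W̃_k(a, b) = det W(a_i, b_j)`. The determinant
expands into signed families of arbitrary walks. In a family where a later walk meets the
loop-erasure of an earlier one, two walks are cut at a canonical common vertex and their tails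
exchanged. This preserves the weight, changes the permutation by a transposition and undoes itself
(`exists_involutive_tailSwap`), so such families cancel.

The minor summation formula (`sum_det_eq_pfaffian`) turns the sum of the maximal minors of a matrix
with finitely many columns into the Pfaffian of the sums of its `2 × 2` minors. It rests on the
Pfaffian of the matrix of order signs of a tuple: the sign of the sorting permutation, or `0` if an
entry repeats.

For infinite `B` the formula is applied to each finite subset of `B`. Both sides converge along
these subsets because a Pfaffian is a polynomial in its entries, and limits are unique in a
Hausdorff ring. In an acyclic graph loop-erasure does nothing, so path families and walk families
coincide. -/

namespace LoopErasedWalks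

/-! ### Pfaffians and the minor summation formula. -/

section Matchings

variable {n : ℕ}

/-- The matching obtained from `f` by relabelling the points along `τ`. -/
def PerfectMatching.relabel (τ : Equiv.Perm (Fin n)) (f : PerfectMatching n) : PerfectMatching n :=
  ⟨τ * f.1 * τ⁻¹, fun i => by
    refine ⟨by simp [(f.2 _).1], fun h => (f.2 (τ⁻¹ i)).2 ?_⟩
    rw [Equiv.Perm.mul_apply, Equiv.Perm.mul_apply] at h
    rw [Equiv.Perm.eq_inv_iff_eq, h]⟩

theorem PerfectMatching.relabel_apply (τ : Equiv.Perm (Fin n)) (f : PerfectMatching n) (i : Fin n) :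
    (f.relabel τ).1 (τ i) = τ (f.1 i) := by
  simp [PerfectMatching.relabel]

theorem PerfectMatching.relabel_relabel_swap (x y : Fin n) (f : PerfectMatching n) :
    (f.relabel (Equiv.swap x y)).relabel (Equiv.swap x y) = f := by
  apply Subtype.ext
  ext i
  simp [PerfectMatching.relabel]

theorem swap_adjacent_lt_iff {x y : Fin n} (hxy : y.val = x.val + 1) (u v : Fin n) :
    Equiv.swap x y u < Equiv.swap x y v ↔ (u < v ∧ ¬ (u = x ∧ v = y)) ∨ (u = y ∧ v = x) := by
  simp only [Equiv.swap_apply_def]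
  split_ifs <;> simp only [Fin.lt_def, Fin.ext_iff] at * <;> omega

variable {R : Type*} [CommRing R]

theorem neg_one_pow_crossings (f : PerfectMatching n) :
    (-1 : R) ^ crossings f = ∏ p : Fin n × Fin n,
      if p.1 < p.2 ∧ p.2 < f.1 p.1 ∧ f.1 p.1 < f.1 p.2 then -1 else 1 := by
  rw [Finset.prod_ite]
  simp [crossings]

theorem prod_eq_neg_prod_of_eq_off {ι : Type*} [Fintype ι] [DecidableEq ι] {g h : ι → R} (p : ι)
    (hp : g p = - h p) (H : ∀ q, q ≠ p → g q = h q) : ∏ q, g q = - ∏ q, h q := by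
  rw [← Finset.mul_prod_erase _ g (Finset.mem_univ p),
    ← Finset.mul_prod_erase _ h (Finset.mem_univ p),
    hp, Finset.prod_congr rfl fun q hq => H q (Finset.ne_of_mem_erase hq), neg_mul]

/-- Exchanging neighbouring labels alters only the relative position of the arcs at `x` and `y`.
These are two different arcs, and their crossing appears or disappears. -/
theorem neg_one_pow_crossings_relabel_swap {x y : Fin n} (hxy : y.val = x.val + 1)
    (f : PerfectMatching n) (hf : f.1 x ≠ y) :
    (-1 : R) ^ crossings (f.relabel (Equiv.swap x y)) = - (-1 : R) ^ crossings f := by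
  rw [neg_one_pow_crossings, neg_one_pow_crossings,
    ← Equiv.prod_comp ((Equiv.swap x y).prodCongr (Equiv.swap x y))]
  simp only [Equiv.prodCongr_apply, Prod.map_fst, Prod.map_snd, PerfectMatching.relabel_apply]
  simp only [swap_adjacent_lt_iff hxy]
  have hff : ∀ i, f.1 (f.1 i) = i := fun i => (f.2 i).1
  have hne : ∀ i, f.1 i ≠ i := fun i => (f.2 i).2
  have hx := hff x
  have hy := hff y
  have hnx := hne x
  have hny := hne y
  -- The factor that flips: `p` lists the left ends of the arcs at `x` and `y`, in their order under
  -- whichever labelling makes these arcs cross.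
  have key : ∃ p : Fin n × Fin n,
      (p = (x, y) ∧ x < f.1 x ∧ y < f.1 y ∧ f.1 x < f.1 y) ∨
      (p = (y, x) ∧ x < f.1 x ∧ y < f.1 y ∧ f.1 y < f.1 x) ∨
      (p = (f.1 x, f.1 y) ∧ f.1 x < x ∧ f.1 y < y ∧ f.1 x < f.1 y) ∨
      (p = (f.1 y, f.1 x) ∧ f.1 x < x ∧ f.1 y < y ∧ f.1 y < f.1 x) ∨
      (p = (f.1 x, y) ∧ f.1 x < x ∧ y < f.1 y) ∨
      (p = (f.1 y, x) ∧ x < f.1 x ∧ f.1 y < y) := by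
    have hxy' : f.1 x ≠ f.1 y := fun h => by
      have := f.1.injective h
      rw [this] at hxy
      omega
    rcases lt_or_gt_of_ne hnx with h1 | h1 <;> rcases lt_or_gt_of_ne hny with h2 | h2 <;>
      rcases lt_or_gt_of_ne hxy' with h3 | h3 <;> simp [h1, h2, h3, not_lt_of_gt]
  obtain ⟨p, hp⟩ := key
  refine prod_eq_neg_prod_of_eq_off p ?_ ?_
  · have hlt : x < y := by rw [Fin.lt_def]; omega
    have hfy : f.1 y ≠ x := fun h => hf (by rw [← h, hy])
    rcases hp with h | h | h | h | h | h <;> obtain ⟨rfl, h⟩ := h <;> dsimp only <;>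
      simp only [hx, hy] <;> split_ifs <;>
      first | rfl | exact (neg_neg _).symm | grind
  · rintro ⟨i, j⟩ hij
    have e1 : f.1 i = x ↔ i = f.1 x := ⟨fun h => by rw [← h, hff], fun h => by rw [h, hff]⟩
    have e2 : f.1 i = y ↔ i = f.1 y := ⟨fun h => by rw [← h, hff], fun h => by rw [h, hff]⟩
    have e3 : f.1 j = x ↔ j = f.1 x := ⟨fun h => by rw [← h, hff], fun h => by rw [h, hff]⟩
    have e4 : f.1 j = y ↔ j = f.1 y := ⟨fun h => by rw [← h, hff], fun h => by rw [h, hff]⟩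
    have hlt : x < y := by rw [Fin.lt_def]; omega
    dsimp only
    refine if_congr ?_ rfl rfl
    rw [e1, e2, e3, e4]
    rcases hp with h | h | h | h | h | h <;> obtain ⟨rfl, h⟩ := h <;> grind

/-- The summand of the Pfaffian of `A` that belongs to the matching `f`. -/
def pfaffianTerm (A : Matrix (Fin n) (Fin n) R) (f : PerfectMatching n) : R :=
  (-1) ^ crossings f * ∏ i with i < f.1 i, A i (f.1 i)

theorem pfaffian_eq_sum_pfaffianTerm (A : Matrix (Fin n) (Fin n) R) :
    pfaffian A = ∑ f, pfaffianTerm A f := rfl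

/-- If `f` matches `x` with `y`, relabelling fixes `f` and the sign comes from `A x y = - A y x`;
otherwise it comes from the crossing number. -/
theorem pfaffianTerm_relabel_swap {x y : Fin n} (hxy : y.val = x.val + 1)
    {A : Matrix (Fin n) (Fin n) R} (hA : ∀ i j, A i j = - A j i) (f : PerfectMatching n) :
    pfaffianTerm A (f.relabel (Equiv.swap x y)) =
      - pfaffianTerm (A.submatrix (Equiv.swap x y) (Equiv.swap x y)) f := by
  have hff : ∀ i, f.1 (f.1 i) = i := fun i => (f.2 i).1
  have hlt : x < y := by rw [Fin.lt_def]; omega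
  unfold pfaffianTerm
  by_cases hf : f.1 x = y
  · have hfy : f.1 y = x := by rw [← hf, hff]
    have hrel : f.relabel (Equiv.swap x y) = f := by
      apply Subtype.ext
      ext i
      obtain ⟨j, rfl⟩ := (Equiv.swap x y).surjective i
      rw [PerfectMatching.relabel_apply]
      by_cases hjx : j = x
      · subst hjx; simp [hf, hfy]
      by_cases hjy : j = y
      · subst hjy; simp [hf, hfy]
      rw [Equiv.swap_apply_of_ne_of_ne hjx hjy, Equiv.swap_apply_of_ne_of_ne]
      · exact fun h => hjy (by rw [← hff j, h, hf])
      · exact fun h => hjx (by rw [← hff j, h, hfy])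
    rw [hrel, ← mul_neg]
    congr 1
    rw [Finset.prod_filter, Finset.prod_filter]
    refine prod_eq_neg_prod_of_eq_off x ?_ fun i hix => ?_
    · simp [hf, hlt, hA x y]
    · by_cases hiy : i = y
      · subst hiy; simp [hfy, hlt.not_gt]
      · rw [Matrix.submatrix_apply, Equiv.swap_apply_of_ne_of_ne hix hiy,
          Equiv.swap_apply_of_ne_of_ne]
        · exact fun h => hiy (by rw [← hff i, h, hf])
        · exact fun h => hix (by rw [← hff i, h, hfy])
  · have hfy : f.1 y ≠ x := fun h => hf (by rw [← h, hff])
    rw [neg_one_pow_crossings_relabel_swap hxy f hf, neg_mul, Finset.prod_filter,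
      Finset.prod_filter, ← Equiv.prod_comp (Equiv.swap x y)]
    simp only [PerfectMatching.relabel_apply, swap_adjacent_lt_iff hxy, Matrix.submatrix_apply]
    congr 2
    refine Finset.prod_congr rfl fun i _ => if_congr ?_ rfl rfl
    grind

theorem pfaffian_submatrix_swap {x y : Fin n} (hxy : y.val = x.val + 1)
    {A : Matrix (Fin n) (Fin n) R} (hA : ∀ i j, A i j = - A j i) :
    pfaffian (A.submatrix (Equiv.swap x y) (Equiv.swap x y)) = - pfaffian A := by
  have h : Function.Involutive (PerfectMatching.relabel (Equiv.swap x y)) :=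
    PerfectMatching.relabel_relabel_swap x y
  rw [pfaffian_eq_sum_pfaffianTerm, pfaffian_eq_sum_pfaffianTerm,
    ← Equiv.sum_comp h.toPerm (pfaffianTerm A),
    ← Finset.sum_neg_distrib]
  exact Finset.sum_congr rfl fun f _ => by
    rw [Function.Involutive.coe_toPerm, pfaffianTerm_relabel_swap hxy hA, neg_neg]

theorem pfaffian_submatrix_perm (π : Equiv.Perm (Fin n))
    {A : Matrix (Fin n) (Fin n) R} (hA : ∀ i j, A i j = - A j i) :
    pfaffian (A.submatrix π π) = ((Equiv.Perm.sign π : ℤ) : R) * pfaffian A := by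
  cases n with
  | zero =>
    rw [Subsingleton.elim π 1]
    simp
  | succ m =>
    have hπ : π ∈ Submonoid.closure (Set.range fun i : Fin m ↦ Equiv.swap i.castSucc i.succ) := by
      rw [Equiv.Perm.mclosure_swap_castSucc_succ]; trivial
    induction hπ using Submonoid.closure_induction generalizing A with
    | one => simp
    | mem π h =>
      obtain ⟨i, rfl⟩ := h
      rw [pfaffian_submatrix_swap (by simp) hA, Equiv.Perm.sign_swap (by simp [Fin.ext_iff])]
      simp
    | mul π ρ _ _ hπ hρ =>
      have h : A.submatrix ⇑(π * ρ) ⇑(π * ρ) = (A.submatrix π π).submatrix ρ ρ := rfl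
      rw [h, hρ (A := A.submatrix π π) fun i j => hA _ _, hπ hA, Equiv.Perm.sign_mul]
      push_cast
      ring

/-- The sign of `y - x` in a linear order. -/
def orderSign (R : Type*) [CommRing R] {β : Type*} [LinearOrder β] (x y : β) : R :=
  if x < y then 1 else if y < x then -1 else 0

theorem orderSign_skew {β : Type*} [LinearOrder β] (x y : β) :
    orderSign R x y = - orderSign R y x := by
  unfold orderSign
  rcases lt_trichotomy x y with h | rfl | h
  · simp [h, h.not_gt]
  · simp
  · simp [h, h.not_gt]

/-- Matchings that do not join `0` to `1` cancel in pairs under exchanging these labels; among the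
rest the same works for `2` and `3`, and so on. Only the crossing-free matching of consecutive
points survives. -/
theorem sum_neg_one_pow_crossings (hn : Even n) :
    ∑ f : PerfectMatching n, (-1 : R) ^ crossings f = 1 := by
  obtain ⟨m, hm⟩ := hn
  -- The first `i` pairs `{2j, 2j + 1}` are arcs of `f`.
  let P : ℕ → PerfectMatching n → Prop := fun i f =>
    ∀ j < i, ∀ x y : Fin n, x.val = 2 * j → y.val = 2 * j + 1 → f.1 x = y
  classical
  have key : ∀ i ≤ m, ∑ f : PerfectMatching n, (-1 : R) ^ crossings f =
      ∑ f with P i f, (-1 : R) ^ crossings f := by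
    intro i
    induction i with
    | zero => intro _; simp [P]
    | succ i ih =>
      intro hi
      rw [ih (by omega)]
      let x : Fin n := ⟨2 * i, by omega⟩
      let y : Fin n := ⟨2 * i + 1, by omega⟩
      have hxy : y.val = x.val + 1 := rfl
      rw [← Finset.sum_filter_add_sum_filter_not _ (fun f : PerfectMatching n => f.1 x = y)]
      have h0 : ∑ f ∈ (Finset.univ.filter (P i)).filter (fun f : PerfectMatching n => ¬ f.1 x = y),
          (-1 : R) ^ crossings f = 0 := by
        refine Finset.sum_involution (fun f _ => f.relabel (Equiv.swap x y)) ?_ ?_ ?_ ?_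
        · intro f hf
          rw [neg_one_pow_crossings_relabel_swap hxy f (Finset.mem_filter.mp hf).2]
          ring
        · intro f hf _ h
          have h1 := (Finset.mem_filter.mp hf).2
          have h2 := PerfectMatching.relabel_apply (Equiv.swap x y) f x
          rw [h, Equiv.swap_apply_left, Equiv.swap_apply_of_ne_of_ne (f.2 x).2 h1] at h2
          have := f.1.injective h2
          simp [x, y] at this
        · intro f hf
          simp only [Finset.mem_filter, Finset.mem_univ, true_and] at hf ⊢
          have hne : ∀ z : Fin n, z.val < 2 * i → Equiv.swap x y z = z := fun z hz =>
            Equiv.swap_apply_of_ne_of_ne (by simp [x, Fin.ext_iff]; omega)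
              (by simp [y, Fin.ext_iff]; omega)
          refine ⟨fun j hj u v hu hv => ?_, fun h => hf.2 ?_⟩
          · rw [← hne u (by omega), PerfectMatching.relabel_apply, hf.1 j hj u v hu hv,
              hne v (by omega)]
          · have h2 := PerfectMatching.relabel_apply (Equiv.swap x y) f y
            rw [Equiv.swap_apply_right, h] at h2
            have h3 : f.1 y = x := by
              rw [← (Equiv.swap x y).injective.eq_iff, ← h2, Equiv.swap_apply_left]
            rw [← h3, (f.2 y).1]
        · intro f _
          exact PerfectMatching.relabel_relabel_swap x y f
      rw [h0, add_zero, Finset.filter_filter]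
      refine Finset.sum_congr (Finset.filter_congr fun f _ => ?_) fun _ _ => rfl
      constructor
      · rintro ⟨h1, h2⟩ j hj u v hu hv
        rcases Nat.lt_succ_iff_lt_or_eq.mp hj with h | rfl
        · exact h1 j h u v hu hv
        · rwa [show u = x from Fin.ext hu, show v = y from Fin.ext hv]
      · exact fun h => ⟨fun j hj => h j (by omega), h i (by omega) x y rfl rfl⟩
  rw [key m le_rfl]
  let g : Fin n → Fin n := fun i =>
    if h : i.val % 2 = 0 then ⟨i.val + 1, by omega⟩ else ⟨i.val - 1, by omega⟩
  have hgv : ∀ i, (g i).val = if i.val % 2 = 0 then i.val + 1 else i.val - 1 := fun i => by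
    simp only [g]
    split_ifs <;> rfl
  have hg : Function.Involutive g := by
    intro i
    rw [Fin.ext_iff, hgv, hgv]
    split_ifs <;> omega
  have hgne : ∀ i, g i ≠ i := by
    intro i
    rw [ne_eq, Fin.ext_iff, hgv]
    split_ifs <;> omega
  have hgval : ∀ i, (g i).val ≤ i.val + 1 := by
    intro i
    rw [hgv]
    split_ifs <;> omega
  let f₀ : PerfectMatching n := ⟨hg.toPerm, fun i => ⟨hg i, hgne i⟩⟩
  have hP : Finset.univ.filter (P m) = {f₀} := by
    ext f
    simp only [Finset.mem_filter, Finset.mem_univ, true_and, Finset.mem_singleton]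
    constructor
    · intro h
      apply Subtype.ext
      ext1 i
      change f.1 i = g i
      by_cases hi : i.val % 2 = 0
      · exact h (i.val / 2) (by omega) i (g i) (by omega) (by simp [g, hi]; omega)
      · have := h (i.val / 2) (by omega) (g i) i (by simp [g, hi]; omega) (by omega)
        conv_lhs => rw [← this]
        exact (f.2 _).1
    · rintro rfl j hj u v hu hv
      apply Fin.ext
      change (g u).val = v.val
      simp [g, hu, hv]
  rw [hP, Finset.sum_singleton]
  have : crossings f₀ = 0 := by
    rw [crossings, Finset.card_eq_zero, Finset.filter_eq_empty_iff]
    rintro ⟨i, j⟩ _ ⟨h1, h2, _⟩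
    have := hgval i
    change j < g i at h2
    simp only [Fin.lt_def] at h1 h2
    omega
  rw [this, pow_zero]

theorem pfaffian_orderSign_of_strictMono {β : Type*} [LinearOrder β] (hn : Even n) {c : Fin n → β}
    (hc : StrictMono c) : pfaffian (Matrix.of fun i j => orderSign R (c i) (c j)) = 1 := by
  rw [← sum_neg_one_pow_crossings (R := R) hn]
  refine Finset.sum_congr rfl fun f _ => ?_
  rw [Finset.prod_eq_one, mul_one]
  intro i hi
  simp [orderSign, hc (Finset.mem_filter.mp hi).2]

/-- After sorting, two neighbouring entries agree, and exchanging them fixes the matrix but negates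
the Pfaffian. As `2` may be a zero divisor, the terms are cancelled in pairs; a matching fixed by
the exchange contains the arc `x — y`, whose entry is `0`. -/
theorem pfaffian_orderSign_of_not_injective {β : Type*} [LinearOrder β] {b : Fin n → β}
    (hb : ¬ Function.Injective b) :
    pfaffian (Matrix.of fun i j => orderSign R (b i) (b j)) = 0 := by
  have hmono := Tuple.monotone_sort b
  set c := b ∘ Tuple.sort b with hc
  obtain ⟨x, y, hxy, hcxy⟩ : ∃ x y : Fin n, y.val = x.val + 1 ∧ c x = c y := by
    by_contra! H
    apply hb
    have hinj : Function.Injective c := by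
      refine StrictMono.injective fun i j hij => lt_of_le_of_ne (hmono hij.le) fun h => ?_
      have hij' : i.val < j.val := hij
      let k : Fin n := ⟨i.val + 1, by omega⟩
      refine H i k rfl (le_antisymm (hmono ?_) (h ▸ hmono ?_))
      · simp [k, Fin.le_def]
      · rw [Fin.le_def]; simp only [k]; omega
    have : b = c ∘ (Tuple.sort b).symm := by ext i; simp [hc]
    rw [this]
    exact hinj.comp (Equiv.injective _)
  have hb' : (Matrix.of fun i j => orderSign R (b i) (b j)) =
      (Matrix.of fun i j => orderSign R (c i) (c j)).submatrix (Tuple.sort b).symm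
        (Tuple.sort b).symm := by
    ext i j; simp [hc]
  rw [hb']
  set A := Matrix.of fun i j => orderSign R (c i) (c j) with hA
  have hskew : ∀ i j, A i j = - A j i := fun i j => orderSign_skew _ _
  rw [pfaffian_submatrix_perm _ hskew]
  have hcs : ∀ i, c (Equiv.swap x y i) = c i := fun i => by
    rw [Equiv.swap_apply_def]; split_ifs with h1 h2
    · rw [h1, hcxy]
    · rw [h2, hcxy]
    · rfl
  have hsub : A.submatrix (Equiv.swap x y) (Equiv.swap x y) = A := by
    ext i j; simp [hA, hcs]
  rw [pfaffian_eq_sum_pfaffianTerm]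
  convert mul_zero _
  refine Finset.sum_involution (fun f _ => f.relabel (Equiv.swap x y)) ?_ ?_ (by simp) ?_
  · intro f _
    rw [pfaffianTerm_relabel_swap hxy hskew, hsub, add_neg_cancel]
  · intro f _ hf h
    by_cases h1 : f.1 x = y
    · apply hf
      unfold pfaffianTerm
      rw [Finset.prod_eq_zero (i := x), mul_zero]
      · rw [Finset.mem_filter, h1, Fin.lt_def]
        exact ⟨Finset.mem_univ _, by omega⟩
      · simp [h1, hA, orderSign, hcxy]
    · have h2 := PerfectMatching.relabel_apply (Equiv.swap x y) f x
      rw [h, Equiv.swap_apply_left, Equiv.swap_apply_of_ne_of_ne (f.2 x).2 h1] at h2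
      have := f.1.injective h2
      rw [this] at hxy
      omega
  · intro f _
    exact PerfectMatching.relabel_relabel_swap x y f

theorem sum_strictMono_fin_two {β : Type*} [Fintype β] [LinearOrder β] (g h : β → R) :
    ∑ c : {c : Fin 2 → β // StrictMono c}, (g (c.1 0) * h (c.1 1) - g (c.1 1) * h (c.1 0)) =
      ∑ p : β × β, orderSign R p.1 p.2 * (g p.1 * h p.2) := by
  have h1 : ∀ p : β × β, orderSign R p.1 p.2 * (g p.1 * h p.2) =
      (if p.1 < p.2 then g p.1 * h p.2 else 0) - (if p.2 < p.1 then g p.1 * h p.2 else 0) := by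
    rintro ⟨x, y⟩
    unfold orderSign
    rcases lt_trichotomy x y with h | rfl | h
    · simp [h, h.not_gt]
    · simp
    · simp [h, h.not_gt]
  have h2 : ∑ p : β × β, (if p.2 < p.1 then g p.1 * h p.2 else 0) =
      ∑ p : β × β, if p.1 < p.2 then g p.2 * h p.1 else 0 :=
    (Equiv.sum_comp (Equiv.prodComm β β) _).symm
  have h3 : ∑ p : β × β, orderSign R p.1 p.2 * (g p.1 * h p.2) = ∑ p : β × β,
      ((if p.1 < p.2 then g p.1 * h p.2 else 0) - if p.1 < p.2 then g p.2 * h p.1 else 0) := by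
    rw [Finset.sum_congr rfl fun p _ => h1 p, Finset.sum_sub_distrib, h2, Finset.sum_sub_distrib]
  rw [h3]
  refine Fintype.sum_of_injective
    (fun c : {c : Fin 2 → β // StrictMono c} => (c.1 0, c.1 1)) ?_ _ _ ?_ ?_
  · rintro c d h
    apply Subtype.ext
    funext i
    fin_cases i
    · exact congrArg Prod.fst h
    · exact congrArg Prod.snd h
  · rintro ⟨x, y⟩ hp
    have : ¬ x < y := fun hxy => hp ⟨⟨![x, y], by
      simpa [Fin.strictMono_iff_lt_succ] using hxy⟩, rfl⟩
    simp [this]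
  · rintro ⟨c, hc⟩
    simp [hc (show (0 : Fin 2) < 1 by decide)]

theorem prod_over_arcs (f : PerfectMatching n) (g : Fin n → R) :
    ∏ i with i < f.1 i, (g i * g (f.1 i)) = ∏ i, g i := by
  rw [← Finset.prod_filter_mul_prod_filter_not Finset.univ (fun i => i < f.1 i),
    Finset.prod_mul_distrib]
  congr 1
  refine Finset.prod_nbij' f.1 f.1 ?_ ?_ ?_ ?_ ?_
  · intro i hi
    simp only [Finset.mem_filter, Finset.mem_univ, true_and, (f.2 _).1] at hi ⊢
    exact hi.not_gt
  · intro i hi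
    simp only [Finset.mem_filter, Finset.mem_univ, true_and, (f.2 _).1] at hi ⊢
    exact lt_of_le_of_ne (not_lt.mp hi) (f.2 i).2
  · exact fun i _ => (f.2 i).1
  · exact fun i _ => (f.2 i).1
  · exact fun i _ => rfl

/-- Labellings of all points correspond to labellings of the arcs of a matching by pairs. -/
def arcLabelEquiv (β : Type*) (f : PerfectMatching n) :
    (Fin n → β) ≃ ({i // i < f.1 i} → β × β) where
  toFun b i := (b i, b (f.1 i))
  invFun p j := if h : j < f.1 j then (p ⟨j, h⟩).1 else
    (p ⟨f.1 j, by rw [(f.2 j).1]; exact lt_of_le_of_ne (not_lt.mp h) (f.2 j).2⟩).2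
  left_inv b := by
    funext j
    dsimp only
    split_ifs
    · rfl
    · rw [(f.2 j).1]
  right_inv p := by
    funext ⟨i, hi⟩
    have h : ¬ f.1 i < f.1 (f.1 i) := by rw [(f.2 i).1]; exact hi.not_gt
    simp only [hi, h, dite_true, dite_false]
    simp only [(f.2 i).1]

/-- Distributivity: choosing a pair of labels for each arc amounts to labelling every point once. -/
theorem prod_arcs_sum {β : Type*} [Fintype β] (f : PerfectMatching n) (s : β → β → R)
    (M : Fin n → β → R) :
    ∏ i with i < f.1 i, ∑ p : β × β, s p.1 p.2 * (M i p.1 * M (f.1 i) p.2) =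
      ∑ b : Fin n → β, (∏ i with i < f.1 i, s (b i) (b (f.1 i))) * ∏ i, M i (b i) := by
  classical
  rw [← Finset.prod_subtype_eq_prod_filter, Finset.subtype_univ, Finset.prod_univ_sum,
    Fintype.piFinset_univ, ← Equiv.sum_comp (arcLabelEquiv β f)]
  refine Finset.sum_congr rfl fun b _ => ?_
  rw [← prod_over_arcs f fun i => M i (b i), ← Finset.prod_mul_distrib,
    ← Finset.prod_subtype_eq_prod_filter, Finset.subtype_univ]
  rfl

/-- The Pfaffian form of the minor summation formula. -/
theorem sum_det_eq_pfaffian {β : Type*} [Fintype β] [LinearOrder β] (hn : Even n)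
    (M : Fin n → β → R) :
    ∑ c : {c : Fin n → β // StrictMono c}, (Matrix.of fun i j => M i (c.1 j)).det =
      pfaffian (Matrix.of fun i j => ∑ c : {c : Fin 2 → β // StrictMono c},
        (M i (c.1 0) * M j (c.1 1) - M i (c.1 1) * M j (c.1 0))) := by
  have h1 : pfaffian (Matrix.of fun i j => ∑ c : {c : Fin 2 → β // StrictMono c},
        (M i (c.1 0) * M j (c.1 1) - M i (c.1 1) * M j (c.1 0))) =
      ∑ b : Fin n → β, (∏ i, M i (b i)) *
        pfaffian (Matrix.of fun i j => orderSign R (b i) (b j)) := by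
    simp only [pfaffian, Matrix.of_apply, sum_strictMono_fin_two, prod_arcs_sum, Finset.mul_sum]
    rw [Finset.sum_comm]
    exact Finset.sum_congr rfl fun b _ => Finset.sum_congr rfl fun f _ => by ring
  have h2 : ∀ c : {c : Fin n → β // StrictMono c}, (Matrix.of fun i j => M i (c.1 j)).det =
      ∑ σ : Equiv.Perm (Fin n), (∏ i, M i (c.1 (σ i))) *
        pfaffian (Matrix.of fun i j => orderSign R (c.1 (σ i)) (c.1 (σ j))) := by
    intro c
    rw [← Matrix.det_transpose, Matrix.det_apply']
    refine Finset.sum_congr rfl fun σ _ => ?_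
    have hskew : ∀ i j, (Matrix.of fun i j => orderSign R (c.1 i) (c.1 j)) i j =
      - (Matrix.of fun i j => orderSign R (c.1 i) (c.1 j)) j i := fun i j => orderSign_skew _ _
    have := pfaffian_submatrix_perm σ hskew
    rw [pfaffian_orderSign_of_strictMono hn c.2, mul_one] at this
    rw [mul_comm, ← this]
    rfl
  rw [h1, Finset.sum_congr rfl fun c _ => h2 c, ← Fintype.sum_prod_type']
  -- An injective labelling is uniquely an increasing tuple composed with a permutation; the other
  -- labellings contribute zero.
  refine Fintype.sum_of_injective
    (fun q : {c : Fin n → β // StrictMono c} × Equiv.Perm (Fin n) => q.1.1 ∘ q.2) ?_ _ _ ?_ ?_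
  · rintro ⟨⟨c, hc⟩, σ⟩ ⟨⟨d, hd⟩, τ⟩ h
    have hcd : c = d := by
      apply (hc.range_inj hd).mp
      have := congrArg Set.range h
      simpa [Set.range_comp] using this
    subst hcd
    simp only [Prod.mk.injEq, true_and]
    ext i : 1
    exact hc.injective (congrFun h i)
  · intro b hb
    rw [pfaffian_orderSign_of_not_injective, mul_zero]
    intro hinj
    refine hb ⟨⟨⟨b ∘ Tuple.sort b, (Tuple.monotone_sort b).strictMono_of_injective
      (hinj.comp (Equiv.injective _))⟩, (Tuple.sort b)⁻¹⟩, ?_⟩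
    ext i
    simp
  · intro q
    rfl

end Matchings

open Quiver

/-! ### Loop-erasure and canonical cuts of a walk. -/

section Splitting

variable {V : Type*} [Quiver V]

theorem takeWhile_ne_append_cons {α : Type*} [DecidableEq α] {c : α} {l : List α} (h : c ∉ l)
    (t : List α) : (l ++ c :: t).takeWhile (· ≠ c) = l := by
  rw [List.takeWhile_append_of_pos, List.takeWhile_cons_of_neg (by simp), List.append_nil]
  intro x hx
  have : x ≠ c := fun h' => h (h' ▸ hx)
  simpa using this

open scoped Classical in
theorem vertices_initialSegment {a : V} : ∀ {b : V} (p : Path a b) (c : V) (h : c ∈ p.vertices),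
    (initialSegment p c h).vertices = p.vertices.takeWhile (· ≠ c) ++ [c]
  | _, Path.nil, c, h => by
    obtain rfl : c = a := List.mem_singleton.mp h
    simp [initialSegment]
  | d, Path.cons p e, c, h => by
    by_cases h' : c ∈ p.vertices
    · obtain ⟨l, t, hl, hc⟩ := List.eq_append_cons_of_mem h'
      rw [initialSegment, dif_pos h', vertices_initialSegment p c h', Path.vertices_cons,
        List.concat_eq_append, hl, List.append_assoc, List.cons_append,
        takeWhile_ne_append_cons hc, takeWhile_ne_append_cons hc]
    · obtain rfl : c = d := ((Path.mem_vertices_cons p e).mp h).resolve_left h'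
      rw [initialSegment, dif_neg h', Path.vertices_cons, List.concat_eq_append,
        takeWhile_ne_append_cons h']

-- Both branches of the recursion take one form on vertex lists: truncate before `c`, then append
-- `c`. Later arguments about loop-erasure rest on this.
open scoped Classical in
theorem vertices_loopErasure_cons {a b c : V} (p : Path a b) (e : b ⟶ c) :
    (loopErasure (p.cons e)).vertices =
      (loopErasure p).vertices.takeWhile (· ≠ c) ++ [c] := by
  rw [loopErasure]
  split_ifs with h
  · rw [vertices_initialSegment]
  · rw [Path.vertices_cons, List.concat_eq_append, List.takeWhile_eq_self_iff.mpr]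
    intro x hx
    simp only [ne_eq, decide_not, Bool.not_eq_eq_eq_not, Bool.not_true, decide_eq_false_iff_not]
    rintro rfl
    exact h hx

theorem start_mem_loopErasure {a b : V} (p : Path a b) : a ∈ (loopErasure p).vertices :=
  Path.start_mem_vertices _

theorem mem_vertices_comp {a b c : V} (p : Path a b) (q : Path b c) {v : V} :
    v ∈ (p.comp q).vertices ↔ v ∈ p.vertices ∨ v ∈ q.vertices := by
  induction q with
  | nil =>
    simp only [Path.comp_nil, Path.vertices_nil, List.mem_singleton]
    exact ⟨Or.inl, fun h => h.elim id fun h => h ▸ p.end_mem_vertices⟩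
  | cons q e ih => rw [Path.comp_cons, Path.mem_vertices_cons, Path.mem_vertices_cons, ih, or_assoc]

/-- The last step of the walk leads to a vertex outside the loop-erasure of the part before it. -/
def EndsFresh {a : V} : ∀ {b : V}, Path a b → Prop
  | _, Path.nil => True
  | c, Path.cons p _ => c ∉ (loopErasure p).vertices

/-- The walk visits its last vertex only once. -/
def EndsNew {a : V} : ∀ {b : V}, Path a b → Prop
  | _, Path.nil => True
  | c, Path.cons p _ => c ∉ p.vertices

/-- A loop closed during `q` cuts back at most to `b`, since `q` never returns to `l`. -/
theorem loopErasure_comp {a b c : V} {p : Path a b} {l : List V}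
    (hp : (loopErasure p).vertices = l ++ [b]) (q : Path b c) (hq : ∀ u ∈ l, u ∉ q.vertices) :
    ∃ t, (loopErasure (p.comp q)).vertices = l ++ b :: t := by
  classical
  induction q with
  | nil => exact ⟨[], hp⟩
  | @cons d c q e ih =>
    obtain ⟨t, ht⟩ := ih fun u hu h => hq u hu ((Path.mem_vertices_cons q e).mpr (Or.inl h))
    rw [Path.comp_cons, vertices_loopErasure_cons, ht, List.takeWhile_append_of_pos]
    · rw [List.takeWhile_cons]
      split_ifs with h
      · exact ⟨_, by rw [List.append_assoc, List.cons_append]⟩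
      · have : b = c := by simpa using h
        exact ⟨[], by simp [this]⟩
    · intro u hu
      have : u ≠ c := fun h => hq u hu ((Path.mem_vertices_cons q e).mpr (Or.inr h))
      simpa using this

/-- The cut is made when `v` enters the loop-erasure for good. The tail may return to `v`, closing
loops there, but never to a vertex of `l`. -/
theorem exists_fresh_split {a b : V} (w : Path a b) {l t : List V} {v : V}
    (h : (loopErasure w).vertices = l ++ v :: t) :
    ∃ (p : Path a v) (q : Path v b), w = p.comp q ∧ EndsFresh p ∧
      (loopErasure p).vertices = l ++ [v] ∧ ∀ u ∈ l, u ∉ q.vertices := by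
  classical
  induction w generalizing l t v with
  | nil =>
    have h' : [a] = l ++ v :: t := h
    obtain rfl : l = [] := by
      cases l with
      | nil => rfl
      | cons x l => simp at h'
    obtain rfl : a = v := by simpa using (List.cons.inj h').1
    exact ⟨Path.nil, Path.nil, rfl, trivial, rfl, by simp⟩
  | @cons d c w e ih =>
    rw [vertices_loopErasure_cons] at h
    have hpre := List.takeWhile_prefix (l := (loopErasure w).vertices) (fun x => decide (x ≠ c))
    have hnot : ∀ u ∈ (loopErasure w).vertices.takeWhile (fun x => decide (x ≠ c)), u ≠ c :=
      fun u hu => by simpa using List.mem_takeWhile_imp hu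
    rcases List.eq_nil_or_concat t with rfl | ⟨t', x, rfl⟩
    · obtain ⟨hl, hc⟩ := List.append_inj' h rfl
      obtain rfl : c = v := by simpa using hc
      -- If the last step closes a loop at `c`, the cut is the earlier moment at which `c` became
      -- part of the loop-erasure.
      by_cases hcm : c ∈ (loopErasure w).vertices
      · obtain ⟨s, hs⟩ : ∃ s, (loopErasure w).vertices = l ++ c :: s := by
          obtain ⟨l', s, hs, hc⟩ := List.eq_append_cons_of_mem hcm
          rw [hs, takeWhile_ne_append_cons hc] at hl
          exact ⟨s, hl ▸ hs⟩
        obtain ⟨p, q, rfl, h1, h2, h3⟩ := ih hs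
        refine ⟨p, q.cons e, rfl, h1, h2, fun u hu hq => ?_⟩
        rcases (Path.mem_vertices_cons q e).mp hq with hq | hq
        · exact h3 u hu hq
        · exact hnot u (hl ▸ hu) hq
      · refine ⟨w.cons e, Path.nil, rfl, hcm, ?_, fun u hu hq => ?_⟩
        · rw [vertices_loopErasure_cons, hl]
        · exact hnot u (hl ▸ hu) (by simpa using hq)
    · have h' : (loopErasure w).vertices.takeWhile (fun x => decide (x ≠ c)) ++ [c] =
        (l ++ v :: t') ++ [x] := by rw [h]; simp
      obtain ⟨hl, -⟩ := List.append_inj' h' rfl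
      obtain ⟨s, hs⟩ := hpre
      rw [hl] at hs hnot
      obtain ⟨p, q, rfl, h1, h2, h3⟩ := ih (l := l) (v := v) (t := t' ++ s) (by rw [← hs]; simp)
      refine ⟨p, q.cons e, rfl, h1, h2, fun u hu hq => ?_⟩
      rcases (Path.mem_vertices_cons q e).mp hq with hq | hq
      · exact h3 u hu hq
      · exact hnot u (by simp [hu]) hq

theorem exists_new_split {a b : V} (w : Path a b) {v : V} (h : v ∈ w.vertices) :
    ∃ (p : Path a v) (q : Path v b), w = p.comp q ∧ EndsNew p := by
  induction w with
  | nil =>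
    obtain rfl : v = a := by simpa using h
    exact ⟨Path.nil, Path.nil, rfl, trivial⟩
  | @cons d c w e ih =>
    by_cases hv : v ∈ w.vertices
    · obtain ⟨p, q, rfl, hp⟩ := ih hv
      exact ⟨p, q.cons e, rfl, hp⟩
    · obtain rfl : v = c := ((Path.mem_vertices_cons w e).mp h).resolve_left hv
      exact ⟨w.cons e, Path.nil, rfl, hv⟩

theorem comp_eq_comp_cases {a u v b : V} (p₁ : Path a u) (p₂ : Path a v) (q₁ : Path u b)
    (q₂ : Path v b) (h : p₁.comp q₁ = p₂.comp q₂) :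
    (∃ r : Path u v, p₂ = p₁.comp r ∧ q₁ = r.comp q₂) ∨
      ∃ r : Path v u, p₁ = p₂.comp r ∧ q₂ = r.comp q₁ := by
  induction q₁ with
  | nil => exact Or.inr ⟨q₂, h, rfl⟩
  | @cons d c q₁ e ih =>
    cases q₂ with
    | nil => exact Or.inl ⟨q₁.cons e, h.symm, rfl⟩
    | @cons d' _ q₂ e' =>
      obtain ⟨rfl, hq, he⟩ := Path.cons.inj h
      obtain rfl := eq_of_heq he
      rcases ih q₂ (eq_of_heq hq) with ⟨r, h1, rfl⟩ | ⟨r, h1, rfl⟩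
      · exact Or.inl ⟨r, h1, rfl⟩
      · exact Or.inr ⟨r, h1, rfl⟩

/-- Between two different cuts lies a closed walk at `v` avoiding `l`. Throughout it `v` stays on
the loop-erasure, so the later cut is not fresh. -/
theorem fresh_split_unique {a v b : V} {p₁ p₂ : Path a v} {q₁ q₂ : Path v b} {l : List V}
    (h : p₁.comp q₁ = p₂.comp q₂) (h₁ : EndsFresh p₁) (h₂ : EndsFresh p₂)
    (hl₁ : (loopErasure p₁).vertices = l ++ [v]) (hl₂ : (loopErasure p₂).vertices = l ++ [v])
    (hq₁ : ∀ u ∈ l, u ∉ q₁.vertices) (hq₂ : ∀ u ∈ l, u ∉ q₂.vertices) :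
    p₁ = p₂ ∧ q₁ = q₂ := by
  have key : ∀ {p : Path a v} {q : Path v b} (r : Path v v), EndsFresh (p.comp r) →
      (loopErasure p).vertices = l ++ [v] → (∀ u ∈ l, u ∉ (r.comp q).vertices) → r = Path.nil := by
    intro p q r h1 h2 h3
    cases r with
    | nil => rfl
    | cons r e =>
      obtain ⟨t, ht⟩ := loopErasure_comp h2 r fun u hu hr => h3 u hu <| by
        rw [mem_vertices_comp, Path.mem_vertices_cons]; exact Or.inl (Or.inl hr)
      exact absurd (by rw [ht]; simp) h1
  rcases comp_eq_comp_cases _ _ _ _ h with ⟨r, rfl, rfl⟩ | ⟨r, rfl, rfl⟩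
  · obtain rfl := key r h₂ hl₁ hq₁
    exact ⟨rfl, by simp⟩
  · obtain rfl := key r h₁ hl₂ hq₂
    exact ⟨rfl, by simp⟩

theorem new_split_unique {a v b : V} {p₁ p₂ : Path a v} {q₁ q₂ : Path v b}
    (h : p₁.comp q₁ = p₂.comp q₂) (h₁ : EndsNew p₁) (h₂ : EndsNew p₂) : p₁ = p₂ ∧ q₁ = q₂ := by
  have key : ∀ {p : Path a v} (r : Path v v), EndsNew (p.comp r) → r = Path.nil := by
    intro p r h1
    cases r with
    | nil => rfl
    | cons r e =>
      exact absurd ((mem_vertices_comp p r).mpr (Or.inr r.start_mem_vertices)) h1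
  rcases comp_eq_comp_cases _ _ _ _ h with ⟨r, rfl, rfl⟩ | ⟨r, rfl, rfl⟩
  · obtain rfl := key r h₂
    exact ⟨rfl, by simp⟩
  · obtain rfl := key r h₁
    exact ⟨rfl, by simp⟩

end Splitting

/-! ### Exchanging the tails of two walks. -/

section TailSwap

variable {V : Type*} [Quiver V] {k : ℕ}

variable (V) in
/-- A walk together with its end points. -/
abbrev AnyWalk : Type _ := Σ u v : V, Path u v

/-- No walk with an index larger than `i` meets the loop-erasure of the walk with index `i`. -/
def ErasureAvoided (W : Fin k → AnyWalk V) (i : Fin k) : Prop :=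
  ∀ m, i < m → ∀ u ∈ (W m).2.2.vertices, u ∉ (loopErasure (W i).2.2).vertices

/-- Data for exchanging the final parts of two walks in a family. The index `i` is the first one
whose loop-erasure is met by a later walk, the walks `i` and `j` are `p q` and `p' q'`, and they are
cut at the first vertex `v` of the loop-erasure of the walk `i` that a later walk visits; `j` is the
first later index whose walk visits `v`, and `l` lists the vertices of the loop-erasure before
`v`. -/
structure TailCut (W : Fin k → AnyWalk V) (i j : Fin k) {x y z t v : V} (p : Path x v)
    (q : Path v y) (p' : Path z v) (q' : Path v t) (l : List V) : Prop where
  lt : i < j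
  left : W i = ⟨x, y, p.comp q⟩
  right : W j = ⟨z, t, p'.comp q'⟩
  fresh : EndsFresh p
  new : EndsNew p'
  erasure : (loopErasure p).vertices = l ++ [v]
  avoid_tail : ∀ u ∈ l, u ∉ q.vertices
  avoid : ∀ m, i < m → ∀ u ∈ l, u ∉ (W m).2.2.vertices
  first : ∀ m, i < m → m < j → v ∉ (W m).2.2.vertices
  before : ∀ m, m < i → ErasureAvoided W m

/-- The family with the final parts of the walks `i` and `j` exchanged. -/
def exchange (W : Fin k → AnyWalk V) (i j : Fin k) {x y z t v : V} (p : Path x v)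
    (q : Path v y) (p' : Path z v) (q' : Path v t) : Fin k → AnyWalk V :=
  Function.update (Function.update W i ⟨x, t, p.comp q'⟩) j
    (⟨z, y, p'.comp q⟩ : AnyWalk V)

/-- The family `W'` arises from `W` by exchanging the final parts of the walks `i` and `j`. -/
def TailSwap (i j : Fin k) (W W' : Fin k → AnyWalk V) : Prop :=
  ∃ (x y z t v : V) (p : Path x v) (q : Path v y) (p' : Path z v) (q' : Path v t) (l : List V),
    TailCut W i j p q p' q' l ∧ W' = exchange W i j p q p' q'

section Exchange

variable {W : Fin k → AnyWalk V} {i j : Fin k} {x y z t v : V} {p : Path x v}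
    {q : Path v y} {p' : Path z v} {q' : Path v t} {l : List V}

theorem exchange_left (hij : i ≠ j) : exchange W i j p q p' q' i = ⟨x, t, p.comp q'⟩ := by
  simp [exchange, hij]

theorem exchange_right : exchange W i j p q p' q' j = ⟨z, y, p'.comp q⟩ := by
  simp [exchange]

theorem exchange_of_ne {m : Fin k} (hi : m ≠ i) (hj : m ≠ j) :
    exchange W i j p q p' q' m = W m := by
  simp [exchange, hi, hj]

theorem TailCut.tail_avoid (h : TailCut W i j p q p' q' l) : ∀ u ∈ l, u ∉ q'.vertices := by
  intro u hu hq
  apply h.avoid j h.lt u hu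
  rw [h.right]
  exact (mem_vertices_comp p' q').mpr (Or.inr hq)

/-- The cut data survive the exchange, so a second exchange undoes the first. Both tails avoid `l`.
For `m < i` the walks `i` and `j` are both later than `m`, and together they visit the same vertices
as before. -/
theorem TailCut.exchange (h : TailCut W i j p q p' q' l) :
    TailCut (exchange W i j p q p' q') i j p q' p' q l := by
  have hne := h.lt.ne
  have hmem : ∀ m u, u ∈ (LoopErasedWalks.exchange W i j p q p' q' m).2.2.vertices → m ≠ i →
      u ∈ (W m).2.2.vertices ∨ m = j ∧ u ∈ q.vertices := by
    intro m u hu hmi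
    by_cases hmj : m = j
    · subst hmj
      rw [exchange_right] at hu
      refine ((mem_vertices_comp p' q).mp hu).imp (fun hu => ?_) fun hu => ⟨rfl, hu⟩
      rw [h.right]
      exact (mem_vertices_comp p' q').mpr (Or.inl hu)
    · rw [exchange_of_ne hmi hmj] at hu
      exact Or.inl hu
  refine ⟨h.lt, exchange_left hne, exchange_right, h.fresh, h.new, h.erasure, h.tail_avoid,
    fun m hm u hu hmu => ?_, fun m hm hmj => ?_, fun m hm n hn u hu => ?_⟩
  · rcases hmem m u hmu hm.ne' with h1 | ⟨-, h1⟩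
    · exact h.avoid m hm u hu h1
    · exact h.avoid_tail u hu h1
  · rw [exchange_of_ne hm.ne' hmj.ne]
    exact h.first m hm hmj
  · rw [exchange_of_ne hm.ne (hm.trans h.lt).ne]
    have hi : ∀ u ∈ (p.comp q).vertices, u ∉ (loopErasure (W m).2.2).vertices := by
      have := h.before m hm i hm
      rwa [h.left] at this
    have hj : ∀ u ∈ (p'.comp q').vertices, u ∉ (loopErasure (W m).2.2).vertices := by
      have := h.before m hm j (hm.trans h.lt)
      rwa [h.right] at this
    by_cases hni : n = i
    · subst hni
      rw [exchange_left hne] at hu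
      rcases (mem_vertices_comp p q').mp hu with hu | hu
      · exact hi u ((mem_vertices_comp p q).mpr (Or.inl hu))
      · exact hj u ((mem_vertices_comp p' q').mpr (Or.inr hu))
    · rcases hmem n u hu hni with h1 | ⟨-, h1⟩
      · exact h.before m hm n hn u h1
      · exact hi u ((mem_vertices_comp p q).mpr (Or.inr h1))

theorem exchange_exchange (h : TailCut W i j p q p' q' l) :
    LoopErasedWalks.exchange (LoopErasedWalks.exchange W i j p q p' q') i j p q' p' q = W := by
  funext m
  by_cases hi : m = i
  · subst hi
    rw [exchange_left h.lt.ne, h.left]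
  by_cases hj : m = j
  · subst hj
    rw [exchange_right, h.right]
  rw [exchange_of_ne hi hj, exchange_of_ne hi hj]

theorem TailCut.meets_left (h : TailCut W i j p q p' q' l) :
    ∃ s, (loopErasure (W i).2.2).vertices = l ++ v :: s := by
  rw [h.left]
  exact loopErasure_comp h.erasure q h.avoid_tail

theorem TailCut.meets_right (h : TailCut W i j p q p' q' l) : v ∈ (W j).2.2.vertices := by
  rw [h.right]
  exact (mem_vertices_comp p' q').mpr (Or.inl p'.end_mem_vertices)

theorem TailCut.not_erasureAvoided (h : TailCut W i j p q p' q' l) : ¬ ErasureAvoided W i := by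
  intro H
  obtain ⟨s, hs⟩ := h.meets_left
  exact H j h.lt v h.meets_right (by rw [hs]; simp)

end Exchange

theorem TailSwap.symm {i j : Fin k} {W W' : Fin k → AnyWalk V} (h : TailSwap i j W W') :
    TailSwap i j W' W := by
  obtain ⟨x, y, z, t, v, p, q, p', q', l, h, rfl⟩ := h
  exact ⟨x, t, z, y, v, p, q', p', q, l, h.exchange, (exchange_exchange h).symm⟩

theorem TailSwap.not_erasureAvoided {i j : Fin k} {W W' : Fin k → AnyWalk V}
    (h : TailSwap i j W W') : ¬ ErasureAvoided W i := by
  obtain ⟨x, y, z, t, v, p, q, p', q', l, h, rfl⟩ := h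
  exact h.not_erasureAvoided

theorem append_cons_first_unique {α : Type*} {P : α → Prop} {l₁ l₂ t₁ t₂ : List α} {v₁ v₂ : α}
    (h : l₁ ++ v₁ :: t₁ = l₂ ++ v₂ :: t₂) (h₁ : ∀ u ∈ l₁, ¬ P u) (h₂ : ∀ u ∈ l₂, ¬ P u)
    (hv₁ : P v₁) (hv₂ : P v₂) : l₁ = l₂ ∧ v₁ = v₂ := by
  induction l₁ generalizing l₂ with
  | nil =>
    cases l₂ with
    | nil => simpa using (List.cons.inj h).1
    | cons x l₂ =>
      obtain rfl : v₁ = x := (List.cons.inj h).1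
      exact absurd hv₁ (h₂ _ (by simp))
  | cons y l₁ ih =>
    cases l₂ with
    | nil =>
      obtain rfl : y = v₂ := (List.cons.inj h).1
      exact absurd hv₂ (h₁ _ (by simp))
    | cons x l₂ =>
      obtain ⟨rfl, h'⟩ := List.cons.inj h
      obtain ⟨rfl, rfl⟩ := ih h' (fun u hu => h₁ u (by simp [hu])) (fun u hu => h₂ u (by simp [hu]))
      exact ⟨rfl, rfl⟩

theorem exists_append_cons_first {α : Type*} {P : α → Prop} {L : List α} (h : ∃ u ∈ L, P u) :
    ∃ l v t, L = l ++ v :: t ∧ P v ∧ ∀ u ∈ l, ¬ P u := by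
  induction L with
  | nil => simp at h
  | cons x L ih =>
    by_cases hx : P x
    · exact ⟨[], x, L, rfl, hx, by simp⟩
    · obtain ⟨l, v, t, rfl, hv, hl⟩ := ih (by simpa [hx] using h)
      exact ⟨x :: l, v, t, rfl, hv, by simpa [hx] using hl⟩

/-- Each choice is a first one, hence determined by `W`: the index `i`, then the vertex `v`, then
`j`. The two cuts are unique by `fresh_split_unique` and `new_split_unique`. -/
theorem TailSwap.unique {i₁ j₁ i₂ j₂ : Fin k} {W W₁ W₂ : Fin k → AnyWalk V}
    (h₁ : TailSwap i₁ j₁ W W₁) (h₂ : TailSwap i₂ j₂ W W₂) : i₁ = i₂ ∧ j₁ = j₂ ∧ W₁ = W₂ := by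
  obtain ⟨x₁, y₁, z₁, t₁, v₁, p₁, q₁, p₁', q₁', l₁, h₁, rfl⟩ := h₁
  obtain ⟨x₂, y₂, z₂, t₂, v₂, p₂, q₂, p₂', q₂', l₂, h₂, rfl⟩ := h₂
  obtain rfl : i₁ = i₂ := by
    rcases lt_trichotomy i₁ i₂ with h | h | h
    · exact absurd (h₂.before _ h) h₁.not_erasureAvoided
    · exact h
    · exact absurd (h₁.before _ h) h₂.not_erasureAvoided
  obtain ⟨s₁, hs₁⟩ := h₁.meets_left
  obtain ⟨s₂, hs₂⟩ := h₂.meets_left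
  obtain ⟨rfl, rfl⟩ := append_cons_first_unique
    (P := fun u => ∃ m, i₁ < m ∧ u ∈ (W m).2.2.vertices) (hs₁.symm.trans hs₂)
    (fun u hu ⟨m, hm, hum⟩ => h₁.avoid m hm u hu hum)
    (fun u hu ⟨m, hm, hum⟩ => h₂.avoid m hm u hu hum)
    ⟨j₁, h₁.lt, h₁.meets_right⟩ ⟨j₂, h₂.lt, h₂.meets_right⟩
  obtain rfl : j₁ = j₂ := by
    rcases lt_trichotomy j₁ j₂ with h | h | h
    · exact absurd h₁.meets_right (h₂.first _ h₁.lt h)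
    · exact h
    · exact absurd h₂.meets_right (h₁.first _ h₂.lt h)
  have e₁ := h₁.left.symm.trans h₂.left
  have e₂ := h₁.right.symm.trans h₂.right
  obtain ⟨rfl, e₁⟩ := Sigma.mk.inj e₁
  obtain ⟨rfl, e₁⟩ := Sigma.mk.inj (eq_of_heq e₁)
  obtain ⟨rfl, e₂⟩ := Sigma.mk.inj e₂
  obtain ⟨rfl, e₂⟩ := Sigma.mk.inj (eq_of_heq e₂)
  obtain ⟨rfl, rfl⟩ := fresh_split_unique (eq_of_heq e₁) h₁.fresh h₂.fresh h₁.erasure h₂.erasure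
    h₁.avoid_tail h₂.avoid_tail
  obtain ⟨rfl, rfl⟩ := new_split_unique (eq_of_heq e₂) h₁.new h₂.new
  exact ⟨rfl, rfl, rfl⟩

theorem exists_tailSwap {W : Fin k → AnyWalk V} (h : ∃ i, ¬ ErasureAvoided W i) :
    ∃ i j W', TailSwap i j W W' := by
  obtain ⟨i, hi, hmin⟩ := exists_minimal_of_wellFoundedLT (fun i => ¬ ErasureAvoided W i) h
  have hbefore : ∀ m, m < i → ErasureAvoided W m := fun m hm => by
    by_contra hc
    exact absurd (hmin hc hm.le) (not_le_of_gt hm)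
  obtain ⟨l, v, s, hs, hv, hl⟩ := exists_append_cons_first
    (P := fun u => ∃ m, i < m ∧ u ∈ (W m).2.2.vertices) (L := (loopErasure (W i).2.2).vertices) (by
      unfold ErasureAvoided at hi
      push Not at hi
      obtain ⟨m, hm, u, hu, hu'⟩ := hi
      exact ⟨u, hu', m, hm, hu⟩)
  obtain ⟨j, ⟨hij, hj⟩, hjmin⟩ := exists_minimal_of_wellFoundedLT
    (fun m => i < m ∧ v ∈ (W m).2.2.vertices) hv
  obtain ⟨p, q, hpq, h1, h2, h3⟩ := exists_fresh_split _ hs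
  obtain ⟨p', q', hpq', h4⟩ := exists_new_split _ hj
  refine ⟨i, j, _, _, _, _, _, _, p, q, p', q', l, ⟨hij, ?_, ?_, h1, h4, h2, h3, ?_, ?_, hbefore⟩,
    rfl⟩
  · rw [← hpq]
  · rw [← hpq']
  · exact fun m hm u hu hum => hl u hu ⟨m, hm, hum⟩
  · exact fun m hm hmj hvm => absurd (hjmin ⟨hm, hvm⟩ hmj.le) (not_le_of_gt hmj)

theorem TailSwap.ne {i j : Fin k} {W W' : Fin k → AnyWalk V} (h : TailSwap i j W W') : i ≠ j := by
  obtain ⟨x, y, z, t, v, p, q, p', q', l, h, rfl⟩ := h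
  exact h.lt.ne

theorem TailSwap.source {i j : Fin k} {W W' : Fin k → AnyWalk V} (h : TailSwap i j W W')
    (m : Fin k) : (W' m).1 = (W m).1 := by
  obtain ⟨x, y, z, t, v, p, q, p', q', l, h, rfl⟩ := h
  by_cases hi : m = i
  · subst hi; rw [exchange_left h.lt.ne, h.left]
  by_cases hj : m = j
  · subst hj; rw [exchange_right, h.right]
  rw [exchange_of_ne hi hj]

theorem TailSwap.target {i j : Fin k} {W W' : Fin k → AnyWalk V} (h : TailSwap i j W W')
    (m : Fin k) : (W' m).2.1 = (W (Equiv.swap i j m)).2.1 := by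
  obtain ⟨x, y, z, t, v, p, q, p', q', l, h, rfl⟩ := h
  by_cases hi : m = i
  · subst hi; rw [exchange_left h.lt.ne, Equiv.swap_apply_left, h.right]
  by_cases hj : m = j
  · subst hj; rw [exchange_right, Equiv.swap_apply_right, h.left]
  rw [exchange_of_ne hi hj, Equiv.swap_apply_of_ne_of_ne hi hj]

theorem prod_eq_prod_of_eq_off_pair {ι R : Type*} [Fintype ι] [DecidableEq ι] [CommMonoid R]
    {g h : ι → R} {i j : ι} (hij : i ≠ j) (H : g i * g j = h i * h j)
    (H' : ∀ m, m ≠ i → m ≠ j → g m = h m) : ∏ m, g m = ∏ m, h m := by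
  have hj : j ∈ Finset.univ.erase i := by simp [hij.symm]
  rw [← Finset.mul_prod_erase _ g (Finset.mem_univ i),
    ← Finset.mul_prod_erase _ h (Finset.mem_univ i),
    ← Finset.mul_prod_erase _ g hj, ← Finset.mul_prod_erase _ h hj, ← mul_assoc, ← mul_assoc, H]
  congr 1
  refine Finset.prod_congr rfl fun m hm => ?_
  simp only [Finset.mem_erase] at hm
  exact H' m hm.2.1 hm.1

theorem TailSwap.prod_weight {R : Type*} [CommRing R] (wt : ∀ {u v : V}, (u ⟶ v) → R)
    {i j : Fin k} {W W' : Fin k → AnyWalk V} (h : TailSwap i j W W') :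
    ∏ m, (W' m).2.2.weight wt = ∏ m, (W m).2.2.weight wt := by
  obtain ⟨x, y, z, t, v, p, q, p', q', l, h, rfl⟩ := h
  refine prod_eq_prod_of_eq_off_pair h.lt.ne ?_ fun m hi hj => ?_
  · rw [exchange_left h.lt.ne, exchange_right, h.left, h.right]
    simp only [Path.weight_comp]
    ring
  · rw [exchange_of_ne hi hj]

end TailSwap

open Filter Topology

/-! ### The sign-reversing involution on bad families. -/

section Involution

theorem exists_involutive_of_rel {Y : Type*} {r : Y → Y → Prop} (htotal : ∀ y, ∃ z, r y z)
    (hsymm : ∀ y z, r y z → r z y) (hunique : ∀ y z z', r y z → r y z' → z = z') :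
    ∃ g : Y → Y, Function.Involutive g ∧ ∀ y, r y (g y) := by
  choose g hg using htotal
  exact ⟨g, fun y => hunique (g y) _ _ (hg _) (hsymm _ _ (hg y)), hg⟩

theorem hasSum_sigma_of_fintype {ι R : Type*} [Fintype ι] {α : ι → Type*} [AddCommMonoid R]
    [TopologicalSpace R] [ContinuousAdd R] {f : (Σ i, α i) → R} {s : ι → R}
    (h : ∀ i, HasSum (fun x => f ⟨i, x⟩) (s i)) : HasSum f (∑ i, s i) := by
  classical
  have key : ∀ i, HasSum (fun y : Σ i, α i => if y.1 = i then f y else 0) (s i) := by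
    intro i
    rw [← (sigma_mk_injective (i := i)).hasSum_iff]
    · convert h i using 2
      simp
    · rintro ⟨j, x⟩ hx
      rw [if_neg]
      rintro rfl
      exact hx ⟨x, rfl⟩
  convert hasSum_sum fun i (_ : i ∈ Finset.univ) => key i using 2 with y
  simp

variable {V : Type*} [Quiver V] {k : ℕ} {a b : Fin k → V}

/-- The walks of a family with their end points. -/
def toAnyWalks (w : AllFamilies a b) : Fin k → AnyWalk V := fun m => ⟨a m, b m, w m⟩

theorem toAnyWalks_injective : Function.Injective (toAnyWalks (a := a) (b := b)) := by
  intro w w' h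
  funext m
  have := congrFun h m
  simpa [toAnyWalks] using this

theorem exists_toAnyWalks_eq {W : Fin k → AnyWalk V} (ha : ∀ m, (W m).1 = a m)
    (hb : ∀ m, (W m).2.1 = b m) : ∃ w : AllFamilies a b, toAnyWalks w = W := by
  have : ∀ m, ∃ p : Path (a m) (b m), (⟨a m, b m, p⟩ : AnyWalk V) = W m := by
    intro m
    rw [← ha m, ← hb m]
    exact ⟨(W m).2.2, rfl⟩
  choose w hw using this
  exact ⟨w, funext hw⟩

/-- The condition that defines `WalkFamilies`. -/
def IsErasureDisjoint (w : AllFamilies a b) : Prop :=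
  ∀ i j, i < j → VertexDisjoint (w j) (loopErasure (w i))

theorem isErasureDisjoint_iff (w : AllFamilies a b) :
    IsErasureDisjoint w ↔ ∀ i, ErasureAvoided (toAnyWalks w) i := Iff.rfl

/-- The families of walks from `a` to a permutation of `b` outside `WalkFamilies`. -/
abbrev BadFamilies (a b : Fin k → V) : Type _ :=
  Σ σ : Equiv.Perm (Fin k), {w : AllFamilies a (b ∘ σ) // ¬ IsErasureDisjoint w}

theorem exists_involutive_tailSwap (a b : Fin k → V) :
    ∃ g : BadFamilies a b → BadFamilies a b, Function.Involutive g ∧ ∀ y, ∃ i j,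
      TailSwap i j (toAnyWalks y.2.1) (toAnyWalks (g y).2.1) ∧
      (g y).1 = y.1 * Equiv.swap i j := by
  refine exists_involutive_of_rel (r := fun y z : BadFamilies a b => ∃ i j,
    TailSwap i j (toAnyWalks y.2.1) (toAnyWalks z.2.1) ∧ z.1 = y.1 * Equiv.swap i j) ?_ ?_ ?_
  · rintro ⟨σ, w, hw⟩
    rw [isErasureDisjoint_iff, not_forall] at hw
    obtain ⟨i, j, W', h⟩ := exists_tailSwap hw
    obtain ⟨w', rfl⟩ := exists_toAnyWalks_eq (a := a) (b := b ∘ ⇑(σ * Equiv.swap i j)) (W := W')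
      h.source h.target
    refine ⟨⟨σ * Equiv.swap i j, w', ?_⟩, i, j, h, rfl⟩
    rw [isErasureDisjoint_iff, not_forall]
    exact ⟨i, h.symm.not_erasureAvoided⟩
  · rintro y z ⟨i, j, h, hz⟩
    exact ⟨i, j, h.symm, by rw [hz, mul_assoc, Equiv.swap_mul_self, mul_one]⟩
  · rintro y ⟨σ, z, hbad⟩ ⟨τ, z', hbad'⟩ ⟨i, j, h, hz⟩ ⟨i', j', h', hz'⟩
    obtain ⟨rfl, rfl, hW⟩ := h.unique h'
    dsimp only at hz hz' hW
    subst hz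
    subst hz'
    obtain rfl := toAnyWalks_injective hW
    rfl

end Involution

/-! ### Fomin's identity for signed walk sums. -/

section Determinant

variable {V : Type*} [Quiver V] {R : Type*} [CommRing R] [TopologicalSpace R]
  [IsTopologicalRing R] [T2Space R] (wt : ∀ {u v : V}, (u ⟶ v) → R) {k : ℕ}

theorem sum_sign_mul_tsum_eq_zero (a b : Fin k → V)
    (hs : ∀ σ : Equiv.Perm (Fin k), Summable fun w : {w : AllFamilies a (b ∘ σ) //
      ¬ IsErasureDisjoint w} => familyWeight wt w.1) :
    ∑ σ : Equiv.Perm (Fin k), ((Equiv.Perm.sign σ : ℤ) : R) *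
      ∑' w : {w : AllFamilies a (b ∘ σ) // ¬ IsErasureDisjoint w}, familyWeight wt w.1 = 0 := by
  classical
  obtain ⟨g, hg, hswap⟩ := exists_involutive_tailSwap a b
  set T : Equiv.Perm (Fin k) → R := fun σ =>
    ∑' w : {w : AllFamilies a (b ∘ σ) // ¬ IsErasureDisjoint w}, familyWeight wt w.1 with hT
  -- Even and odd bad families are summed separately and matched by `g`; knowing only that the
  -- signed sum equals its negative would not suffice when `2` is a zero divisor.
  let F : ℤˣ → BadFamilies a b → R := fun ε y =>
    if Equiv.Perm.sign y.1 = ε then familyWeight wt y.2.1 else 0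
  have hF : ∀ ε, HasSum (F ε) (∑ σ, if Equiv.Perm.sign σ = ε then T σ else 0) := by
    intro ε
    refine hasSum_sigma_of_fintype fun σ => ?_
    by_cases h : Equiv.Perm.sign σ = ε
    · simpa [F, h] using (hs σ).hasSum
    · simp [F, h, hasSum_zero]
  have hFg : F 1 ∘ g = F (-1) := by
    funext y
    obtain ⟨i, j, h, hσ⟩ := hswap y
    have hw : familyWeight wt (g y).2.1 = familyWeight wt y.2.1 := h.prod_weight wt
    have hsign : Equiv.Perm.sign (g y).1 = - Equiv.Perm.sign y.1 := by
      rw [hσ, Equiv.Perm.sign_mul, Equiv.Perm.sign_swap h.ne, mul_neg, mul_one]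
    simp only [F, Function.comp_apply, hw, hsign, neg_eq_iff_eq_neg]
  have h1 : HasSum (F 1 ∘ g) (∑ σ, if Equiv.Perm.sign σ = 1 then T σ else 0) :=
    (hg.toPerm.hasSum_iff (f := F 1)).mpr (hF 1)
  rw [hFg] at h1
  have h2 := h1.unique (hF (-1))
  rw [← sub_eq_zero, ← Finset.sum_sub_distrib] at h2
  rw [← h2]
  refine Finset.sum_congr rfl fun σ _ => ?_
  rcases Int.units_eq_one_or (Equiv.Perm.sign σ) with h | h
  · simp [h, hT]
  · simp [h, hT]

/-- The sum of the weights of all walks from `u` to `v`. -/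
noncomputable def walkSum (u v : V) : R := ∑' p : Path u v, p.weight wt

/-- Walks are split off one at a time. The product of two convergent sums requires summability of
the joint family, hence the hypothesis on all subfamilies. -/
theorem hasSum_familyWeight (a b : Fin k → V)
    (h : ∀ (m : ℕ) (ι : Fin m ↪ Fin k),
      Summable fun w : AllFamilies (a ∘ ι) (b ∘ ι) => familyWeight wt w) :
    HasSum (fun w : AllFamilies a b => familyWeight wt w) (∏ i, walkSum wt (a i) (b i)) := by
  induction k with
  | zero =>
    have : ∀ w : AllFamilies a b, familyWeight wt w = 1 := fun w => by simp [familyWeight]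
    simp only [this, Finset.univ_eq_empty, Finset.prod_empty]
    exact hasSum_unique (fun _ : AllFamilies a b => (1 : R))
  | succ k ih =>
    have h0 : Summable fun p : Path (a 0) (b 0) => p.weight wt := by
      have h1 := h 1 ⟨fun _ => 0, Function.injective_of_subsingleton _⟩
      let e := (Equiv.piUnique fun _ : Fin 1 => Path (a 0) (b 0)).symm
      have h2 := e.summable_iff.mpr h1
      convert h2 using 2 with p
      simp [familyWeight, e]
    have ht := ih (fun i => a i.succ) (fun i => b i.succ)
      fun m ι => h m (ι.trans ⟨Fin.succ, Fin.succ_injective k⟩)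
    have hall := h (k + 1) (Function.Embedding.refl _)
    let e := Fin.consEquiv fun i => Path (a i) (b i)
    rw [Fin.prod_univ_succ]
    have he : (fun q : Path (a 0) (b 0) × AllFamilies (fun i => a i.succ) (fun i => b i.succ) =>
        q.1.weight wt * familyWeight wt q.2) =
        (fun w : AllFamilies a b => familyWeight wt w) ∘ e := by
      funext q
      simp [familyWeight, e, Fin.prod_univ_succ]
    rw [← e.hasSum_iff, ← he]
    refine h0.hasSum.mul ht ?_
    rw [he]
    exact e.summable_iff.mpr hall

theorem signedWalkSum_eq_det {B : Set V} {a : Fin k → V} (hW : WalkSumsConverge wt B a)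
    (hfam : ∀ b : Fin k → B,
      Summable fun w : WalkFamilies a (fun i => (b i : V)) => familyWeight wt w.1)
    (b : Fin k → B) :
    signedWalkSum wt a (fun i => (b i : V)) =
      (Matrix.of fun i j => walkSum wt (a i) (b j)).det := by
  set b' : Fin k → V := fun i => (b i : V) with hb'
  have hall : ∀ σ : Equiv.Perm (Fin k),
      HasSum (fun w : AllFamilies a (b' ∘ σ) => familyWeight wt w)
        (∏ i, walkSum wt (a i) (b (σ i))) := fun σ =>
    hasSum_familyWeight wt a (b' ∘ σ) fun m ι => hW m ι fun i => b (σ (ι i))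
  have hgood : ∀ σ : Equiv.Perm (Fin k), Summable
      ((fun w : AllFamilies a (b' ∘ σ) => familyWeight wt w) ∘
        (Subtype.val : {w : AllFamilies a (b' ∘ σ) | IsErasureDisjoint w} → _)) :=
    fun σ => hfam (b ∘ σ)
  -- `R` need not be complete, so summability does not pass to subfamilies automatically; here it
  -- follows from that of all families and of the good ones.
  have hbad : ∀ σ : Equiv.Perm (Fin k), Summable
      ((fun w : AllFamilies a (b' ∘ σ) => familyWeight wt w) ∘
        (Subtype.val : ↥({w : AllFamilies a (b' ∘ σ) | IsErasureDisjoint w}ᶜ) → _)) :=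
    fun σ => (hgood σ).summable_compl_iff.mpr (hall σ).summable
  rw [← Matrix.det_transpose, Matrix.det_apply']
  have hzero := sum_sign_mul_tsum_eq_zero wt a b' hbad
  unfold signedWalkSum
  rw [← add_zero (Finset.sum _ _), ← hzero, ← Finset.sum_add_distrib]
  refine Finset.sum_congr rfl fun σ _ => ?_
  rw [← mul_add]
  congr 1
  exact ((hgood σ).tsum_add_tsum_compl (hbad σ)).trans (hall σ).tsum_eq

end Determinant

/-! ### Acyclic graphs: path families are walk families. -/

section Acyclic

variable {V : Type*} [Quiver V]

theorem IsAcyclic.notMem_of_cons (hV : IsAcyclic V) {a b c : V} (p : Path a b) (e : b ⟶ c) :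
    c ∉ p.vertices := by
  intro hc
  obtain ⟨p₁, p₂, -⟩ := exists_new_split p hc
  exact Path.cons_ne_nil p₂ e (hV c (p₂.cons e))

theorem IsAcyclic.loopErasure_eq (hV : IsAcyclic V) {a b : V} (p : Path a b) :
    loopErasure p = p := by
  induction p with
  | nil => rfl
  | cons p e ih => rw [loopErasure, dif_neg (by rw [ih]; exact hV.notMem_of_cons p e), ih]

theorem IsAcyclic.nodup_vertices (hV : IsAcyclic V) {a b : V} (p : Path a b) :
    p.vertices.Nodup := by
  induction p with
  | nil => simp
  | cons p e ih =>
    rw [Path.vertices_cons, List.nodup_concat]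
    exact ⟨hV.notMem_of_cons p e, ih⟩

variable {R : Type*} [CommRing R] [TopologicalSpace R] (wt : ∀ {u v : V}, (u ⟶ v) → R)

theorem IsAcyclic.pathQ_eq_walkQ (hV : IsAcyclic V) (B : Set V) [LinearOrder B] {k : ℕ}
    (a : Fin k → V) : pathQ wt B a = walkQ wt B a := by
  refine tsum_congr fun b => Finset.sum_congr rfl fun σ _ => congrArg _ ?_
  refine (Equiv.subtypeEquivRight fun w => ?_).tsum_eq
    (fun w : WalkFamilies a ((fun i => (b.1 i : V)) ∘ σ) => familyWeight wt w.1)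
  simp only [hV.loopErasure_eq]
  refine ⟨fun h i j hij => h.2 j i hij.ne',
    fun h => ⟨fun i => hV.nodup_vertices _, fun i j hij => ?_⟩⟩
  rcases lt_or_gt_of_ne hij with hij | hij
  · exact fun v hi hj => h i j hij v hj hi
  · exact h j i hij

end Acyclic

/-! ### The entries with `k = 2`. -/

section Pairs

variable {V : Type*} [Quiver V] {R : Type*} [CommRing R] [TopologicalSpace R]
  (wt : ∀ {u v : V}, (u ⟶ v) → R)

theorem comp_vecCons_pair {α : Type*} {k : ℕ} (a : Fin k → α) (i j : Fin k) :
    ![a i, a j] = a ∘ ![i, j] := by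
  funext m
  fin_cases m <;> rfl

theorem WalkSumsConverge.pair {B : Set V} {k : ℕ} {a : Fin k → V}
    (hW : WalkSumsConverge wt B a) {i j : Fin k} (hij : i ≠ j) : WalkSumsConverge wt B ![a i, a j] := by
  intro m ι b
  have hinj : Function.Injective ![i, j] := by
    intro x y
    fin_cases x <;> fin_cases y <;> simp [hij, hij.symm]
  rw [comp_vecCons_pair]
  exact hW m (ι.trans ⟨![i, j], hinj⟩) b

/-- Both walks start at `u`, which lies on every loop-erasure, so there are no admissible families.
-/
theorem walkQ_pair_self (B : Set V) [LinearOrder B] (u : V) : walkQ wt B ![u, u] = 0 := by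
  have hempty : ∀ b : Fin 2 → V, IsEmpty (WalkFamilies ![u, u] b) := fun b => ⟨fun w =>
    w.2 0 1 (by decide) u (Path.start_mem_vertices (w.1 1)) (start_mem_loopErasure (w.1 0))⟩
  have h : ∀ b : Fin 2 → V, signedWalkSum wt ![u, u] b = 0 := fun b => by
    refine Finset.sum_eq_zero fun σ _ => ?_
    have := hempty (b ∘ σ)
    rw [tsum_empty, mul_zero]
  simp [walkQ, h]

end Pairs

/-! ### Sums over increasing tuples as limits over finite subsets. -/

section Limit

variable {R : Type*} [AddCommMonoid R] [TopologicalSpace R]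

/-- The tuples with entries in `S` eventually contain any finite set of tuples. Thus sums over
tuples of different lengths become limits along the same directed set. -/
theorem tendsto_sum_strictMono {β : Type*} [LinearOrder β] {k : ℕ}
    {F : (Fin k → β) → R} (hF : Summable fun b : {b : Fin k → β // StrictMono b} => F b.1) :
    Tendsto (fun S : Finset β =>
        ∑ c : {c : Fin k → S // StrictMono c}, F fun i => (c.1 i : β)) atTop
      (𝓝 (∑' b : {b : Fin k → β // StrictMono b}, F b.1)) := by
  let E : ∀ S : Finset β, {c : Fin k → S // StrictMono c} ↪ {b : Fin k → β // StrictMono b} :=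
    fun S => ⟨fun c => ⟨fun i => (c.1 i : β), fun i j hij => c.2 hij⟩, fun c d h => by
      apply Subtype.ext
      funext i
      exact Subtype.ext (congrFun (congrArg Subtype.val h) i)⟩
  have hE : ∀ (S : Finset β) (b : {b : Fin k → β // StrictMono b}),
      b ∈ Finset.univ.map (E S) ↔ ∀ i, b.1 i ∈ S := by
    intro S b
    rw [Finset.mem_map]
    constructor
    · rintro ⟨c, -, rfl⟩ i
      exact (c.1 i).2
    · intro h
      exact ⟨⟨fun i => ⟨b.1 i, h i⟩, fun i j hij => b.2 hij⟩, Finset.mem_univ _, rfl⟩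
  have hlim : Tendsto (fun S : Finset β => Finset.univ.map (E S)) atTop atTop := by
    refine tendsto_atTop_finset_of_monotone (fun S T hST b hb => ?_) fun b => ?_
    · rw [hE] at hb ⊢
      exact fun i => hST (hb i)
    · exact ⟨Finset.univ.image b.1, (hE _ _).mpr fun i =>
        Finset.mem_image_of_mem _ (Finset.mem_univ i)⟩
  have := (hF.hasSum.comp hlim :)
  refine this.congr fun S => ?_
  exact Finset.sum_map _ _ _

end Limit

/-! ### Passage to the limit and skew-symmetry. -/

section Main

variable {V : Type*} [Quiver V] {R : Type*} [CommRing R] [TopologicalSpace R]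
  [IsTopologicalRing R] [T2Space R] (wt : ∀ {u v : V}, (u ⟶ v) → R) {B : Set V}

theorem signedWalkSum_pair {k : ℕ} {a : Fin k → V} (hW : WalkSumsConverge wt B a) {i j : Fin k}
    (hij : i ≠ j) (hfam : ∀ b : Fin 2 → B,
      Summable fun w : WalkFamilies ![a i, a j] (fun i => (b i : V)) => familyWeight wt w.1)
    (b : Fin 2 → B) :
    signedWalkSum wt ![a i, a j] (fun m => (b m : V)) =
      walkSum wt (a i) (b 0) * walkSum wt (a j) (b 1) -
        walkSum wt (a i) (b 1) * walkSum wt (a j) (b 0) := by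
  rw [signedWalkSum_eq_det wt (hW.pair wt hij) hfam, Matrix.det_fin_two]
  rfl

theorem walkQ_eq_pfaffian [LinearOrder B] {k : ℕ} (hk : Even k) (a : Fin k → V)
    (hW : WalkSumsConverge wt B a) (hQ : QSumsConverge wt B a)
    (hQ₂ : ∀ i j, QSumsConverge wt B ![a i, a j]) :
    walkQ wt B a = pfaffian (Matrix.of fun i j => walkQ wt B ![a i, a j]) := by
  have hleft := tendsto_sum_strictMono (F := fun b : Fin k → B =>
    signedWalkSum wt a fun i => (b i : V)) hQ.tuples
  have hright : ∀ i j, i ≠ j → Tendsto (fun S : Finset B =>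
      ∑ c : {c : Fin 2 → S // StrictMono c},
        (walkSum wt (a i) (c.1 0 : B) * walkSum wt (a j) (c.1 1 : B) -
          walkSum wt (a i) (c.1 1 : B) * walkSum wt (a j) (c.1 0 : B))) atTop
      (𝓝 (walkQ wt B ![a i, a j])) := by
    intro i j hij
    have := tendsto_sum_strictMono (F := fun b : Fin 2 → B =>
      signedWalkSum wt ![a i, a j] fun m => (b m : V)) (hQ₂ i j).tuples
    refine this.congr fun S => Finset.sum_congr rfl fun c _ => ?_
    exact signedWalkSum_pair wt hW hij (hQ₂ i j).families fun m => (c.1 m : B)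
  refine tendsto_nhds_unique (hleft.congr fun S => ?_) (f := fun S : Finset B =>
    pfaffian (Matrix.of fun i j => ∑ c : {c : Fin 2 → S // StrictMono c},
        (walkSum wt (a i) (c.1 0 : B) * walkSum wt (a j) (c.1 1 : B) -
          walkSum wt (a i) (c.1 1 : B) * walkSum wt (a j) (c.1 0 : B)))) ?_
  · rw [← sum_det_eq_pfaffian hk fun i (s : S) => walkSum wt (a i) (s : B)]
    exact Finset.sum_congr rfl fun c _ =>
      signedWalkSum_eq_det wt hW hQ.families fun m => (c.1 m : B)
  · refine tendsto_finsetSum _ fun f _ =>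
      tendsto_const_nhds.mul (tendsto_finsetProd _ fun i _ => ?_)
    -- A matching has no fixed points, so only off-diagonal entries need to converge.
    exact hright i (f.1 i) (f.2 i).2.symm

theorem walkQ_pair_swap [LinearOrder B] {k : ℕ} {a : Fin k → V}
    (hW : WalkSumsConverge wt B a) (hQ₂ : ∀ i j, QSumsConverge wt B ![a i, a j]) (i j : Fin k) :
    walkQ wt B ![a j, a i] = - walkQ wt B ![a i, a j] := by
  by_cases hij : i = j
  · subst hij
    rw [walkQ_pair_self, neg_zero]
  · unfold walkQ
    rw [← tsum_neg]
    refine tsum_congr fun b => ?_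
    rw [signedWalkSum_pair wt hW hij (hQ₂ i j).families,
      signedWalkSum_pair wt hW (Ne.symm hij) (hQ₂ j i).families]
    ring

end Main

end LoopErasedWalks

open LoopErasedWalks in
/-- Let `G` be a directed graph on `V` with edge weights in a Hausdorff commutative topological ring
(any commutative ring with the discrete topology, if all sums are finite), and let `B` be an ordered
set of vertices. For even `k` and every `k`-tuple `a` of vertices for which the sums involved
converge, the matrix `Q̃₂(a_i, a_j)` is skew-symmetric with zero diagonal and its Pfaffian is
`Q̃_k(a)`. If `G` is acyclic, the Pfaffian identity also holds with families of pairwise disjoint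
paths in place of loop-erasure-disjoint families of walks. -/
theorem mainTheorem2 {V : Type*} [Quiver V] {R : Type*} [CommRing R] [TopologicalSpace R]
    [IsTopologicalRing R] [T2Space R] (wt : ∀ {u v : V}, (u ⟶ v) → R)
    (B : Set V) [LinearOrder B] {k : ℕ} (hk : Even k) (a : Fin k → V)
    (hW : WalkSumsConverge wt B a) (hQ : QSumsConverge wt B a)
    (hQ₂ : ∀ i j, QSumsConverge wt B ![a i, a j]) :
    (∀ i, walkQ wt B ![a i, a i] = 0) ∧
    (∀ i j, walkQ wt B ![a j, a i] = - walkQ wt B ![a i, a j]) ∧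
    walkQ wt B a = pfaffian (Matrix.of fun i j => walkQ wt B ![a i, a j]) ∧
    (IsAcyclic V →
      pathQ wt B a = pfaffian (Matrix.of fun i j => pathQ wt B ![a i, a j])) := by
  refine ⟨fun i => walkQ_pair_self wt B (a i), walkQ_pair_swap wt hW hQ₂,
    walkQ_eq_pfaffian wt hk a hW hQ hQ₂, fun hV => ?_⟩
  simp only [hV.pathQ_eq_walkQ]
  exact walkQ_eq_pfaffian wt hk a hW hQ hQ₂
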